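/- Let $E$ be a normed vector space over $\mathbb K=\mathbb R$ or $\mathbb C$, let $\mathbf y$ be a continuous linear functional on $E$, and let $(\mathbf S_n)_{n\ge 0}$ be a sequence in $E$. The first topological $\varepsilon$-algorithm is defined, for $k,n\ge 0$, by $\widehat{\boldsymbol\varepsilon}_{-1}^{(n)}=\mathbf 0\in E^*$, $\widehat{\boldsymbol\varepsilon}_{0}^{(n)}=\mathbf S_n$ and $$\widehat{\boldsymbol\varepsilon}_{2k+1}^{(n)}=\widehat{\boldsymbol\varepsilon}_{2k-1}^{(n+1)}+\frac{\mathbf y}{\langle \mathbf y,\widehat{\boldsymbol\varepsilon}_{2k}^{(n+1)}-\widehat{\boldsymbol\varepsilon}_{2k}^{(n)}\rangle}\in E^*,$$ $$\widehat{\boldsymbol\varepsilon}_{2k+2}^{(n)}=\widehat{\boldsymbol\varepsilon}_{2k}^{(n+1)}+\frac{\widehat{\boldsymbol\varepsilon}_{2k}^{(n+1)}-\widehat{\boldsymbol\varepsilon}_{2k}^{(n)}}{\langle \widehat{\boldsymbol\varepsilon}_{2k+1}^{(n+1)}-\widehat{\boldsymbol\varepsilon}_{2k+1}^{(n)},\widehat{\boldsymbol\varepsilon}_{2k}^{(n+1)}-\widehat{\boldsymbol\varepsilon}_{2k}^{(n)}\rangle}\in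 E .$$ The first simplified topological $\varepsilon$-algorithm starts from the same $\widehat{\boldsymbol\varepsilon}_{0}^{(n)}=\mathbf S_n$ and uses the single rule $$\widehat{\boldsymbol\varepsilon}_{2k+2}^{(n)}=\widehat{\boldsymbol\varepsilon}_{2k}^{(n+1)}+\frac{\widehat{\boldsymbol\varepsilon}_{2k}^{(n+1)}-\widehat{\boldsymbol\varepsilon}_{2k}^{(n)}}{(\varepsilon_{2k}^{(n+1)}-\varepsilon_{2k}^{(n)})(\varepsilon_{2k+1}^{(n+1)}-\varepsilon_{2k+1}^{(n)})},$$ where the scalars are given by $\varepsilon_{-1}^{(n)}=0$, $\varepsilon_0^{(n)}=\langle \mathbf y,\mathbf S_n\rangle$, $\varepsilon_{k+1}^{(n)}=\varepsilon_{k-1}^{(n+1)}+(\varepsilon_k^{(n+1)}-\varepsilon_k^{(n)})^{-1}$. **Theorem.** Let $\mathbf S\in E$, $b\in\mathbb K$, and let $a_i\in\mathbb K$, $\mathbf u_i\in E$ for $i\ge 1$ be such that $a_1\langle\mathbf y,\mathbf u_1\rangle\neq 0$ and $$\mathbf S_n-\mathbf S\sim\sum_{i=1}^\infty a_i(n+b)^{-i}\mathbf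 u_i\qquad(n\to\infty),$$ that is, $\mathbf S_n-\mathbf S-\sum_{i=1}^N a_i(n+b)^{-i}\mathbf u_i=o((n+b)^{-N})$ for every $N\ge 0$. Then, for each fixed $k\geq 0$: 1. for all sufficiently large $n$, $\langle \mathbf y,\widehat{\boldsymbol\varepsilon}_{2k}^{(n+1)}-\widehat{\boldsymbol\varepsilon}_{2k}^{(n)}\rangle\ne0$, $\langle \widehat{\boldsymbol\varepsilon}_{2k+1}^{(n+1)}-\widehat{\boldsymbol\varepsilon}_{2k+1}^{(n)},\widehat{\boldsymbol\varepsilon}_{2k}^{(n+1)}-\widehat{\boldsymbol\varepsilon}_{2k}^{(n)}\rangle\neq 0$ and $\varepsilon_k^{(n+1)}\ne\varepsilon_k^{(n)}$, so that all divisions are possible for large $n$ in each column, and both algorithms give the same $\widehat{\boldsymbol\varepsilon}_{2k}^{(n)}$ for large $n$; 2. as $n\to\infty$, $$\widehat{\boldsymbol\varepsilon}_{2k}^{(n)}-\mathbf S\sim\frac{a_1\mathbf u_1}{(k+1)(n+b)},$$ that is, the difference of the two sides is $o$ of the norm of the right-hand side; 3. for every $l>k$, the sequence $(\widehat{\boldsymbol\varepsilon}_{2l}^{(n)})_n$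 does not converge to $\mathbf S$ faster than $(\widehat{\boldsymbol\varepsilon}_{2k}^{(n)})_n$: the ratio $\|\widehat{\boldsymbol\varepsilon}_{2l}^{(n)}-\mathbf S\|/\|\widehat{\boldsymbol\varepsilon}_{2k}^{(n)}-\mathbf S\|$ does not tend to $0$ as $n\to\infty$. (Values of the arrays at the finitely many $n$ of a column where a division is impossible are irrelevant; there $1/0$ may be read as $0$.) -/

import Mathlib

open Filter Asymptotics

/-- Wynn's scalar epsilon-algorithm: `scalarEps s k n` is `ε_k^{(n)}`, with `ε_{-1}^{(n)} = 0`,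
`ε_0^{(n)} = s n` and `ε_{k+1}^{(n)} = ε_{k-1}^{(n+1)} + (ε_k^{(n+1)} - ε_k^{(n)})⁻¹`. -/
def scalarEps {𝕜 : Type*} [Field 𝕜] (s : ℕ → 𝕜) : ℕ → ℕ → 𝕜
  | 0 => fun n => s n
  | 1 => fun n => 0 + (s (n + 1) - s n)⁻¹
  | k + 2 => fun n =>
      scalarEps s k (n + 1) + (scalarEps s (k + 1) (n + 1) - scalarEps s (k + 1) n)⁻¹

/-- The odd rule of the first topological epsilon-algorithm: from the columns
`o = ε̂_{2k-1}` (in the algebraic dual) and `e = ε̂_{2k}` (in `E`) it produces `ε̂_{2k+1}`. -/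
def topEpsOddRule {𝕜 E : Type*} [Field 𝕜] [AddCommGroup E] [Module 𝕜 E]
    (y : Module.Dual 𝕜 E) (o : ℕ → Module.Dual 𝕜 E) (e : ℕ → E) (n : ℕ) : Module.Dual 𝕜 E :=
  o (n + 1) + (y (e (n + 1) - e n))⁻¹ • y

/-- The even rule of the first topological epsilon-algorithm: from the columns
`e = ε̂_{2k}` and `o = ε̂_{2k+1}` it produces `ε̂_{2k+2}`. -/
def topEpsEvenRule {𝕜 E : Type*} [Field 𝕜] [AddCommGroup E] [Module 𝕜 E]
    (e : ℕ → E) (o : ℕ → Module.Dual 𝕜 E) (n : ℕ) : E :=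
  e (n + 1) + ((o (n + 1) - o n) (e (n + 1) - e n))⁻¹ • (e (n + 1) - e n)

/-- The two consecutive columns `(ε̂_{2k-1}, ε̂_{2k})` of the first topological
epsilon-algorithm applied to the sequence `S` with the linear functional `y`. -/
def topEpsColumns {𝕜 E : Type*} [Field 𝕜] [AddCommGroup E] [Module 𝕜 E]
    (y : Module.Dual 𝕜 E) (S : ℕ → E) : ℕ → (ℕ → Module.Dual 𝕜 E) × (ℕ → E)
  | 0 => (fun _ => 0, S)
  | k + 1 =>
      (topEpsOddRule y (topEpsColumns y S k).1 (topEpsColumns y S k).2,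
        topEpsEvenRule (topEpsColumns y S k).2
          (topEpsOddRule y (topEpsColumns y S k).1 (topEpsColumns y S k).2))

/-- `topEpsEven y S k n` is `ε̂_{2k}^{(n)}`, an element of `E`. -/
def topEpsEven {𝕜 E : Type*} [Field 𝕜] [AddCommGroup E] [Module 𝕜 E]
    (y : Module.Dual 𝕜 E) (S : ℕ → E) (k n : ℕ) : E :=
  (topEpsColumns y S k).2 n

/-- `topEpsOdd y S k n` is `ε̂_{2k+1}^{(n)}`, an element of the algebraic dual of `E`. -/
def topEpsOdd {𝕜 E : Type*} [Field 𝕜] [AddCommGroup E] [Module 𝕜 E]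
    (y : Module.Dual 𝕜 E) (S : ℕ → E) (k n : ℕ) : Module.Dual 𝕜 E :=
  (topEpsColumns y S (k + 1)).1 n

theorem topEpsEven_zero {𝕜 E : Type*} [Field 𝕜] [AddCommGroup E] [Module 𝕜 E]
    (y : Module.Dual 𝕜 E) (S : ℕ → E) (n : ℕ) : topEpsEven y S 0 n = S n := rfl

theorem topEpsOdd_zero {𝕜 E : Type*} [Field 𝕜] [AddCommGroup E] [Module 𝕜 E]
    (y : Module.Dual 𝕜 E) (S : ℕ → E) (n : ℕ) :
    topEpsOdd y S 0 n = 0 + (y (topEpsEven y S 0 (n + 1) - topEpsEven y S 0 n))⁻¹ • y := rfl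

theorem topEpsOdd_succ {𝕜 E : Type*} [Field 𝕜] [AddCommGroup E] [Module 𝕜 E]
    (y : Module.Dual 𝕜 E) (S : ℕ → E) (k n : ℕ) :
    topEpsOdd y S (k + 1) n = topEpsOdd y S k (n + 1) +
      (y (topEpsEven y S (k + 1) (n + 1) - topEpsEven y S (k + 1) n))⁻¹ • y := rfl

theorem topEpsEven_succ {𝕜 E : Type*} [Field 𝕜] [AddCommGroup E] [Module 𝕜 E]
    (y : Module.Dual 𝕜 E) (S : ℕ → E) (k n : ℕ) :
    topEpsEven y S (k + 1) n = topEpsEven y S k (n + 1) +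
      ((topEpsOdd y S k (n + 1) - topEpsOdd y S k n)
        (topEpsEven y S k (n + 1) - topEpsEven y S k n))⁻¹ •
          (topEpsEven y S k (n + 1) - topEpsEven y S k n) := rfl

/-- The first simplified topological epsilon-algorithm: the columns `ε̂_{2k}^{(n)}` computed
with the scalar epsilon-algorithm applied to the scalar sequence `⟨y, S n⟩`. -/
def simplTopEps {𝕜 E : Type*} [Field 𝕜] [AddCommGroup E] [Module 𝕜 E]
    (y : Module.Dual 𝕜 E) (S : ℕ → E) : ℕ → ℕ → E
  | 0 => S
  | k + 1 => fun n =>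
      simplTopEps y S k (n + 1) +
        ((scalarEps (fun m => y (S m)) (2 * k) (n + 1) -
            scalarEps (fun m => y (S m)) (2 * k) n) *
          (scalarEps (fun m => y (S m)) (2 * k + 1) (n + 1) -
            scalarEps (fun m => y (S m)) (2 * k + 1) n))⁻¹ •
          (simplTopEps y S k (n + 1) - simplTopEps y S k n)

/-- The asymptotic expansion (in the sense of Poincaré)
`S n - L ∼ ∑_{i ≥ 1} a i (n + b)^{-i} u i` as `n → ∞`:
for each `N`, truncating after the term of index `N` leaves an error `o((n + b)^{-N})`. -/
def HasLogExpansion {𝕜 E : Type*} [RCLike 𝕜] [NormedAddCommGroup E] [NormedSpace 𝕜 E]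
    (S : ℕ → E) (L : E) (a : ℕ → 𝕜) (b : 𝕜) (u : ℕ → E) : Prop :=
  ∀ N : ℕ,
    (fun n : ℕ => S n - L - ∑ i ∈ Finset.Icc 1 N, (a i * (((n : 𝕜) + b) ^ i)⁻¹) • u i)
      =o[atTop] (fun n : ℕ => (((n : 𝕜) + b) ^ N)⁻¹)

/-!
# The topological epsilon-algorithm on logarithmically convergent sequences

Put `x n = 1 / (n + b)`. Sequences with an asymptotic expansion to all orders in powers of `x` are
closed under sums, products, inversion (when the limit is nonzero) and, because
`x (n + 1) = x n / (1 + x n)`, under the shift `n ↦ n + 1`. So the entries of the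
epsilon-algorithm keep full expansions, up to a factor `x` or `x ^ (-2)`, and one only has to follow
leading coefficients. The full expansion is what makes this possible: from `f = L + x p` with
`p → v` alone nothing follows about `f (n + 1) - f n`, but if `p` is expandable the difference is
`x ^ 2 D` with `D → -v` (`HasExpansion.exists_sub_eq_sq_smul`), and likewise
`o = h / x ^ 2` with `h → γ` has differences `t / x` with `t → 2 γ`
(`HasExpansion.exists_sub_eq_inv_mul`).

Write `v = a₁ u₁` and `α = ⟨y, v⟩ ≠ 0`. By induction on the column (`ColumnExpansion.succ`),
`ε̂_{2k} = L + x p` with `p → v / (k + 1)` and `ε̂_{2k+1} = (h / x ^ 2) y` with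
`h → -(k + 1) (k + 2) / (2 α)`: the odd rule adds `-(k + 1) / α` to the coefficient of `ε̂_{2k-1}`,
and the even rule multiplies the coefficient of `ε̂_{2k}` by `1 - 1 / (k + 2)`. The coefficients
never vanish, so no divisor does for large `n`. Away from zero divisors, `y` intertwines the
topological algorithm with the scalar one (`eventually_scalarEps_eq`), which gives the claims on
the scalar algorithm and on the simplified algorithm. All even columns thus converge at the same
rate `x`, and the ratio of two of them has a nonzero limit.
-/

/-! ### Asymptotic expansions in powers of a null sequence -/

section PowerExpansions

open scoped Topology

variable {𝕜 E F : Type*} [NontriviallyNormedField 𝕜] [NormedAddCommGroup E] [NormedSpace 𝕜 E]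
  [NormedAddCommGroup F] [NormedSpace 𝕜 F]

/-- `HasExpansionTo x N f` says that `f` is a polynomial of degree less than `N` in the scale `x`
with coefficients in `E`, up to an error `O(x ^ N)`. The coefficients are split off one at a time,
so that closure properties follow by induction on `N`. -/
def HasExpansionTo (x : ℕ → 𝕜) : ℕ → (ℕ → E) → Prop
  | 0, f => f =O[atTop] fun _ => (1 : ℝ)
  | N + 1, f => ∃ (c : E) (g : ℕ → E), HasExpansionTo x N g ∧ f =ᶠ[atTop] fun n => c + x n • g n

namespace HasExpansionTo

variable {x : ℕ → 𝕜} {N : ℕ} {f g : ℕ → E}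

theorem congr (hf : HasExpansionTo x N f) (h : f =ᶠ[atTop] g) : HasExpansionTo x N g := by
  cases N with
  | zero => exact IsBigO.congr' hf h (EventuallyEq.refl _ _)
  | succ N =>
    obtain ⟨c, p, hp, hfp⟩ := hf
    exact ⟨c, p, hp, h.symm.trans hfp⟩

theorem isBigO_one_smul (hx : Tendsto x atTop (𝓝 0)) (hf : f =O[atTop] fun _ => (1 : ℝ)) :
    (fun n => x n • f n) =O[atTop] fun _ => (1 : ℝ) := by
  simpa using (hx.isBigO_one ℝ).smul hf

theorem of_succ (hx : Tendsto x atTop (𝓝 0)) (hf : HasExpansionTo x (N + 1) f) :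
    HasExpansionTo x N f := by
  induction N generalizing f with
  | zero =>
    obtain ⟨c, p, hp, hfp⟩ := hf
    exact IsBigO.congr' ((isBigO_const_const c one_ne_zero _).add (isBigO_one_smul hx hp))
      hfp.symm (EventuallyEq.refl _ _)
  | succ N ih =>
    obtain ⟨c, p, hp, hfp⟩ := hf
    exact ⟨c, p, ih hp, hfp⟩

theorem isBigO_one (hx : Tendsto x atTop (𝓝 0)) (hf : HasExpansionTo x N f) :
    f =O[atTop] fun _ => (1 : ℝ) := by
  induction N with
  | zero => exact hf
  | succ N ih => exact ih (hf.of_succ hx)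

theorem tendsto_of_eq_add_smul (hx : Tendsto x atTop (𝓝 0)) {c : E} (hg : HasExpansionTo x N g)
    (h : f =ᶠ[atTop] fun n => c + x n • g n) : Tendsto f atTop (𝓝 c) := by
  have h₁ : Tendsto (fun n => x n • g n) atTop (𝓝 0) :=
    NormedField.tendsto_zero_smul_of_tendsto_zero_of_bounded hx
      ((isBigO_one_iff ℝ).1 (hg.isBigO_one hx))
  simpa using (tendsto_const_nhds.add h₁).congr' h.symm

theorem zero (x : ℕ → 𝕜) (N : ℕ) : HasExpansionTo x N fun _ => (0 : E) := by
  induction N with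
  | zero => exact isBigO_const_const _ one_ne_zero _
  | succ N ih => exact ⟨0, _, ih, by simp [EventuallyEq.refl]⟩

theorem const (x : ℕ → 𝕜) (N : ℕ) (c : E) : HasExpansionTo x N fun _ => c := by
  cases N with
  | zero => exact isBigO_const_const _ one_ne_zero _
  | succ N => exact ⟨c, _, zero x N, by simp [EventuallyEq.refl]⟩

theorem add (hf : HasExpansionTo x N f) (hg : HasExpansionTo x N g) :
    HasExpansionTo x N fun n => f n + g n := by
  induction N generalizing f g with
  | zero => exact IsBigO.add hf hg
  | succ N ih =>
    obtain ⟨c, p, hp, hfp⟩ := hf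
    obtain ⟨d, q, hq, hgq⟩ := hg
    refine ⟨c + d, _, ih hp hq, ?_⟩
    filter_upwards [hfp, hgq] with n h₁ h₂
    rw [h₁, h₂]
    module

theorem scale_smul (hx : Tendsto x atTop (𝓝 0)) (hf : HasExpansionTo x N f) :
    HasExpansionTo x N fun n => x n • f n :=
  of_succ hx ⟨0, f, hf, by simp [EventuallyEq.refl]⟩

theorem smul (hx : Tendsto x atTop (𝓝 0)) {s : ℕ → 𝕜} (hs : HasExpansionTo x N s)
    (hf : HasExpansionTo x N f) : HasExpansionTo x N fun n => s n • f n := by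
  induction N generalizing s f with
  | zero =>
    show (fun n => s n • f n) =O[atTop] fun _ => (1 : ℝ)
    simpa using IsBigO.smul hs hf
  | succ N ih =>
    obtain ⟨c, p, hp, hfp⟩ := hs
    obtain ⟨d, q, hq, hgq⟩ := hf
    refine ⟨c • d, _, ((ih (const x N c) hq).add (ih hp (const x N d))).add
      ((ih hp hq).scale_smul hx), ?_⟩
    filter_upwards [hfp, hgq] with n h₁ h₂
    rw [h₁, h₂]
    simp only [smul_eq_mul]
    module

theorem inv (hx : Tendsto x atTop (𝓝 0)) {s : ℕ → 𝕜} {c : 𝕜} (hs : HasExpansionTo x N s)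
    (hlim : Tendsto s atTop (𝓝 c)) (hc : c ≠ 0) : HasExpansionTo x N fun n => (s n)⁻¹ := by
  induction N generalizing s with
  | zero => exact (hlim.inv₀ hc).isBigO_one ℝ
  | succ N ih =>
    have hi := ih (hs.of_succ hx) hlim
    obtain ⟨d, p, hp, hsp⟩ := hs
    obtain rfl : d = c := tendsto_nhds_unique (tendsto_of_eq_add_smul hx hp hsp) hlim
    -- the identity used is `1 / (d + x p) = 1 / d + x (- p / (d (d + x p)))`
    refine ⟨d⁻¹, _, (hp.smul hx hi).smul hx (const x N (-d⁻¹)), ?_⟩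
    filter_upwards [hsp, hlim.eventually_ne hc] with n h₁ h₂
    simp only [smul_eq_mul]
    field_simp
    rw [h₁, smul_eq_mul]
    ring

theorem clm (y : E →L[𝕜] F) (hf : HasExpansionTo x N f) : HasExpansionTo x N fun n => y (f n) := by
  induction N generalizing f with
  | zero => exact (y.isBigO_comp f atTop).trans hf
  | succ N ih =>
    obtain ⟨c, p, hp, hfp⟩ := hf
    refine ⟨y c, _, ih hp, ?_⟩
    filter_upwards [hfp] with n h
    simp [h]

/-- The shift replaces `c + x p` by `c + x r p'`, where `p'` is the shift of `p`. -/
theorem shift (hx : Tendsto x atTop (𝓝 0)) (hf : HasExpansionTo x N f) {r : ℕ → 𝕜}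
    (hr : HasExpansionTo x N r) (hxr : ∀ᶠ n in atTop, x (n + 1) = x n * r n) :
    HasExpansionTo x N fun n => f (n + 1) := by
  induction N generalizing f with
  | zero => exact IsBigO.comp_tendsto hf (tendsto_add_atTop_nat 1)
  | succ N ih =>
    obtain ⟨c, p, hp, hfp⟩ := hf
    refine ⟨c, _, (hr.of_succ hx).smul hx (ih hp (hr.of_succ hx)), ?_⟩
    filter_upwards [hxr, (tendsto_add_atTop_nat 1).eventually hfp] with n h₁ h₂
    rw [h₂, h₁, mul_smul]

/-- The inductive definition follows from the usual one by partial sums. The sum includes the term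
of index `N`, of the order of the error, to match `HasLogExpansion`. -/
theorem of_isBigO (hx₀ : ∀ᶠ n in atTop, x n ≠ 0) (c : ℕ → E)
    (h : (fun n => f n - ∑ i ∈ Finset.range (N + 1), x n ^ i • c i) =O[atTop] fun n => x n ^ N) :
    HasExpansionTo x N f := by
  induction N generalizing f c with
  | zero =>
    have h' : (fun n => f n - c 0) =O[atTop] fun _ => (1 : ℝ) := by
      refine IsBigO.trans (by simpa using h) (isBigO_const_const (1 : 𝕜) one_ne_zero _)
    refine (h'.add (isBigO_const_const (c 0) one_ne_zero _)).congr_left fun n => ?_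
    simp
  | succ N ih =>
    refine ⟨c 0, fun n => (x n)⁻¹ • (f n - c 0), ih (fun i => c (i + 1)) ?_, ?_⟩
    · have h' := (isBigO_refl (fun n => (x n)⁻¹) atTop).smul h
      refine h'.congr' ?_ ?_
      · filter_upwards [hx₀] with n hn
        rw [Finset.sum_range_succ' _ (N + 1)]
        simp only [smul_sub, smul_add, Finset.smul_sum, smul_smul, pow_succ, pow_zero, one_smul]
        have : ∀ i : ℕ, (x n)⁻¹ * (x n ^ i * x n) = x n ^ i := fun i => by field_simp
        simp only [this]
        rw [Finset.sum_range_succ _ N]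
        abel
      · filter_upwards [hx₀] with n hn
        rw [smul_eq_mul, pow_succ]
        field_simp
    · filter_upwards [hx₀] with n hn
      rw [smul_smul, mul_inv_cancel₀ hn, one_smul]
      abel

end HasExpansionTo

/-- `HasExpansion x f c` says that `f` has an asymptotic expansion to all orders in powers of `x`,
with constant term `c`, which may be zero. The higher coefficients are not recorded. -/
structure HasExpansion (x : ℕ → 𝕜) (f : ℕ → E) (c : E) : Prop where
  toOrder : ∀ N, HasExpansionTo x N f
  tendsto : Tendsto f atTop (𝓝 c)

/-- A harmonic scale: the sequence `x` is eventually nonzero, tends to zero and is carried to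
`x / (1 + x)` by the shift, like `n ↦ 1 / (n + b)`. -/
structure IsHarmonicScale (x : ℕ → 𝕜) : Prop where
  tendsto_zero : Tendsto x atTop (𝓝 0)
  eventually_ne : ∀ᶠ n in atTop, x n ≠ 0
  shift_eq : ∀ᶠ n in atTop, x (n + 1) = x n * (1 + x n)⁻¹

namespace HasExpansion

variable {x : ℕ → 𝕜} {f g : ℕ → E} {c d : E}

theorem const (x : ℕ → 𝕜) (c : E) : HasExpansion x (fun _ => c) c :=
  ⟨fun N => .const x N c, tendsto_const_nhds⟩

theorem add (hf : HasExpansion x f c) (hg : HasExpansion x g d) :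
    HasExpansion x (fun n => f n + g n) (c + d) :=
  ⟨fun N => (hf.toOrder N).add (hg.toOrder N), hf.tendsto.add hg.tendsto⟩

theorem smul (hx : IsHarmonicScale x) {s : ℕ → 𝕜} {a : 𝕜} (hs : HasExpansion x s a)
    (hf : HasExpansion x f c) : HasExpansion x (fun n => s n • f n) (a • c) :=
  ⟨fun N => (hs.toOrder N).smul hx.tendsto_zero (hf.toOrder N), hs.tendsto.smul hf.tendsto⟩

theorem mul (hx : IsHarmonicScale x) {s t : ℕ → 𝕜} {a b : 𝕜} (hs : HasExpansion x s a)
    (ht : HasExpansion x t b) : HasExpansion x (fun n => s n * t n) (a * b) :=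
  hs.smul hx ht

theorem neg (hx : IsHarmonicScale x) (hf : HasExpansion x f c) :
    HasExpansion x (fun n => -f n) (-c) := by
  simpa using (const x (-1 : 𝕜)).smul hx hf

theorem sub (hx : IsHarmonicScale x) (hf : HasExpansion x f c) (hg : HasExpansion x g d) :
    HasExpansion x (fun n => f n - g n) (c - d) := by
  simpa [sub_eq_add_neg] using hf.add (hg.neg hx)

theorem inv (hx : IsHarmonicScale x) {s : ℕ → 𝕜} {a : 𝕜} (hs : HasExpansion x s a) (ha : a ≠ 0) :
    HasExpansion x (fun n => (s n)⁻¹) a⁻¹ :=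
  ⟨fun N => (hs.toOrder N).inv hx.tendsto_zero hs.tendsto ha, hs.tendsto.inv₀ ha⟩

theorem clm (y : E →L[𝕜] F) (hf : HasExpansion x f c) : HasExpansion x (fun n => y (f n)) (y c) :=
  ⟨fun N => (hf.toOrder N).clm y, (y.continuous.tendsto c).comp hf.tendsto⟩

theorem scale (hx : IsHarmonicScale x) : HasExpansion x x 0 :=
  ⟨fun N => by simpa using (HasExpansionTo.const x N (1 : 𝕜)).scale_smul hx.tendsto_zero,
    hx.tendsto_zero⟩

theorem one_add_scale (hx : IsHarmonicScale x) : HasExpansion x (fun n => 1 + x n) 1 := by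
  simpa using (const x (1 : 𝕜)).add (scale hx)

theorem inv_one_add_scale (hx : IsHarmonicScale x) : HasExpansion x (fun n => (1 + x n)⁻¹) 1 := by
  simpa using (one_add_scale hx).inv hx one_ne_zero

theorem shift (hx : IsHarmonicScale x) (hf : HasExpansion x f c) :
    HasExpansion x (fun n => f (n + 1)) c :=
  ⟨fun N => (hf.toOrder N).shift hx.tendsto_zero ((inv_one_add_scale hx).toOrder N) hx.shift_eq,
    hf.tendsto.comp (tendsto_add_atTop_nat 1)⟩

/-- Splitting off the constant term. The remainder is again expandable to all orders, because
at every order it must agree with `(f - c) / x`. -/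
theorem exists_eq_add_smul (hx : IsHarmonicScale x) (hf : HasExpansion x f c) :
    ∃ g d, HasExpansion x g d ∧ f =ᶠ[atTop] fun n => c + x n • g n := by
  have key : ∀ {N : ℕ} {h : ℕ → E} {e : E}, HasExpansionTo x (N + 1) h → Tendsto h atTop (𝓝 e) →
      HasExpansionTo x N fun n => (x n)⁻¹ • (h n - e) := by
    rintro N h e ⟨d, p, hp, hhp⟩ hlim
    obtain rfl : d = e :=
      tendsto_nhds_unique (hp.tendsto_of_eq_add_smul hx.tendsto_zero hhp) hlim
    refine hp.congr ?_
    filter_upwards [hhp, hx.eventually_ne] with n h₁ h₂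
    rw [h₁, add_sub_cancel_left, smul_smul, inv_mul_cancel₀ h₂, one_smul]
  have hg : ∀ N, HasExpansionTo x N fun n => (x n)⁻¹ • (f n - c) := fun N =>
    key (hf.toOrder (N + 1)) hf.tendsto
  obtain ⟨d, p, hp, hgp⟩ := hg 1
  refine ⟨_, d, ⟨hg, hp.tendsto_of_eq_add_smul hx.tendsto_zero hgp⟩, ?_⟩
  filter_upwards [hx.eventually_ne] with n hn
  rw [smul_smul, mul_inv_cancel₀ hn, one_smul]
  abel

/-- A sequence `L + x p` has differences of order `x ^ 2`, as `1 / n` does. -/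
theorem exists_sub_eq_sq_smul (hx : IsHarmonicScale x) {L : E} {p : ℕ → E}
    (hp : HasExpansion x p c) (hf : f =ᶠ[atTop] fun n => L + x n • p n) :
    ∃ D, HasExpansion x D (-c) ∧ ∀ᶠ n in atTop, f (n + 1) - f n = x n ^ 2 • D n := by
  obtain ⟨q, e, hq, hpq⟩ := hp.exists_eq_add_smul hx
  have hr := inv_one_add_scale hx
  -- expand `x' c + x' ^ 2 q' - x c - x ^ 2 q`
  -- with `x' = x / (1 + x)` and `x' - x = - x ^ 2 / (1 + x)`
  refine ⟨fun n => (((1 + x n)⁻¹ * (1 + x n)⁻¹) • q (n + 1) - q n) - (1 + x n)⁻¹ • c, ?_, ?_⟩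
  · simpa using (((hr.mul hx hr).smul hx (hq.shift hx)).sub hx hq).sub hx (hr.smul hx (const x c))
  · have h1 : ∀ᶠ n in atTop, 1 + x n ≠ 0 := (one_add_scale hx).tendsto.eventually_ne one_ne_zero
    filter_upwards [hf, hpq, (tendsto_add_atTop_nat 1).eventually hf,
      (tendsto_add_atTop_nat 1).eventually hpq, hx.shift_eq, h1] with n h₁ h₂ h₃ h₄ h₅ h₆
    rw [h₁, h₃, h₂, h₄, h₅]
    have h₇ : x n * (1 + x n)⁻¹ = x n - x n ^ 2 * (1 + x n)⁻¹ := by field_simp; ring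
    have h₈ : (x n * (1 + x n)⁻¹) • c = x n • c - (x n ^ 2 * (1 + x n)⁻¹) • c := by
      rw [h₇, sub_smul]
    rw [smul_add, h₈]
    module

/-- A sequence `h / x ^ 2` has differences of order `1 / x`, as `n ^ 2` does. -/
theorem exists_sub_eq_inv_mul (hx : IsHarmonicScale x) {o h : ℕ → 𝕜} {γ : 𝕜}
    (hh : HasExpansion x h γ) (ho : o =ᶠ[atTop] fun n => (x n ^ 2)⁻¹ * h n) :
    ∃ t, HasExpansion x t (2 * γ) ∧ ∀ᶠ n in atTop, o (n + 1) - o n = (x n)⁻¹ * t n := by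
  obtain ⟨q, e, hq, hhq⟩ := hh.exists_eq_add_smul hx
  -- expand `((1 + x) / x) ^ 2 (γ + x q' / (1 + x)) - (γ + x q) / x ^ 2`
  refine ⟨fun n => (2 + x n) * γ + ((1 + x n) * q (n + 1) - q n), ?_, ?_⟩
  · simpa using (((const x (2 : 𝕜)).add (scale hx)).mul hx (const x γ)).add
      (((one_add_scale hx).mul hx (hq.shift hx)).sub hx hq)
  · have h1 : ∀ᶠ n in atTop, 1 + x n ≠ 0 := (one_add_scale hx).tendsto.eventually_ne one_ne_zero
    filter_upwards [ho, hhq, (tendsto_add_atTop_nat 1).eventually ho,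
      (tendsto_add_atTop_nat 1).eventually hhq, hx.shift_eq, h1, hx.eventually_ne]
      with n h₁ h₂ h₃ h₄ h₅ h₆ h₇
    rw [h₁, h₃, h₂, h₄, h₅]
    simp only [smul_eq_mul]
    field_simp
    ring

end HasExpansion

end PowerExpansions

/-! ### Reduction of the topological algorithm to the scalar one -/

section ScalarReduction

variable {𝕜 E : Type*} [Field 𝕜] [AddCommGroup E] [Module 𝕜 E] {y : Module.Dual 𝕜 E} {S : ℕ → E}

/-- `sub_smul` on the dual, stated for the subtraction that occurs in the algorithm: the two
instances of subtraction agree only after unfolding. -/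
theorem dual_smul_sub_smul (y : Module.Dual 𝕜 E) (s t : 𝕜) : s • y - t • y = (s - t) • y :=
  (sub_smul s t y).symm

theorem topEpsOdd_eq (y : Module.Dual 𝕜 E) (S : ℕ → E) (k n : ℕ) :
    topEpsOdd y S k n = (topEpsColumns y S k).1 (n + 1) +
      (y (topEpsEven y S k (n + 1) - topEpsEven y S k n))⁻¹ • y := rfl

/-- Applying `y` to the topological algorithm gives the scalar one: `⟨y, ε̂_{2k}⟩ = ε_{2k}` and
`ε̂_{2k+1} = ε_{2k+1} y`, wherever no division by zero has occurred. -/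
theorem eventually_scalarEps_eq (hdiv : ∀ k, ∀ᶠ n in atTop,
      y (topEpsEven y S k (n + 1) - topEpsEven y S k n) ≠ 0) (k : ℕ) :
    (∀ᶠ n in atTop, y (topEpsEven y S k n) = scalarEps (fun m => y (S m)) (2 * k) n) ∧
    (∀ᶠ n in atTop, topEpsOdd y S k n = scalarEps (fun m => y (S m)) (2 * k + 1) n • y) := by
  induction k with
  | zero =>
    refine ⟨Eventually.of_forall fun n => rfl, Eventually.of_forall fun n => ?_⟩
    rw [topEpsOdd_zero, map_sub, zero_add]
    simp [scalarEps, topEpsEven_zero]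
  | succ k ih =>
    obtain ⟨he, ho⟩ := ih
    have he' : ∀ᶠ n in atTop,
        y (topEpsEven y S (k + 1) n) = scalarEps (fun m => y (S m)) (2 * (k + 1)) n := by
      filter_upwards [hdiv k, he, (tendsto_add_atTop_nat 1).eventually he, ho,
        (tendsto_add_atTop_nat 1).eventually ho] with n h₀ h₁ h₂ h₃ h₄
      rw [topEpsEven_succ, h₃, h₄, dual_smul_sub_smul, map_add, map_smul, h₂, LinearMap.smul_apply,
        smul_eq_mul, smul_eq_mul, mul_inv, inv_mul_cancel_right₀ h₀]
      rfl
    refine ⟨he', ?_⟩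
    filter_upwards [he', (tendsto_add_atTop_nat 1).eventually he',
      (tendsto_add_atTop_nat 1).eventually ho] with n h₁ h₂ h₃
    rw [topEpsOdd_succ, h₃, map_sub, h₁, h₂, ← add_smul]
    rfl

theorem eventually_scalarEps_sub_ne_zero (hdiv : ∀ k, ∀ᶠ n in atTop,
      y (topEpsEven y S k (n + 1) - topEpsEven y S k n) ≠ 0 ∧
      (topEpsOdd y S k (n + 1) - topEpsOdd y S k n)
        (topEpsEven y S k (n + 1) - topEpsEven y S k n) ≠ 0) (k : ℕ) :
    ∀ᶠ n in atTop,
      scalarEps (fun m => y (S m)) k (n + 1) - scalarEps (fun m => y (S m)) k n ≠ 0 := by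
  have hred := eventually_scalarEps_eq fun k => (hdiv k).mono fun n h => h.1
  obtain ⟨j, rfl | rfl⟩ := k.even_or_odd'
  · filter_upwards [hdiv j, (hred j).1, (tendsto_add_atTop_nat 1).eventually (hred j).1]
      with n h₀ h₁ h₂
    rw [← h₁, ← h₂, ← map_sub]
    exact h₀.1
  · filter_upwards [hdiv j, (hred j).2, (tendsto_add_atTop_nat 1).eventually (hred j).2]
      with n h₀ h₁ h₂ h
    apply h₀.2
    rw [h₁, h₂, dual_smul_sub_smul, h, zero_smul, LinearMap.zero_apply]

theorem eventually_simplTopEps_eq (hdiv : ∀ k, ∀ᶠ n in atTop,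
      y (topEpsEven y S k (n + 1) - topEpsEven y S k n) ≠ 0) (k : ℕ) :
    ∀ᶠ n in atTop, simplTopEps y S k n = topEpsEven y S k n := by
  induction k with
  | zero => exact Eventually.of_forall fun n => rfl
  | succ k ih =>
    obtain ⟨he, ho⟩ := eventually_scalarEps_eq hdiv k
    filter_upwards [ih, (tendsto_add_atTop_nat 1).eventually ih, he,
      (tendsto_add_atTop_nat 1).eventually he, ho, (tendsto_add_atTop_nat 1).eventually ho]
      with n h₁ h₂ h₃ h₄ h₅ h₆
    simp only [simplTopEps]
    rw [topEpsEven_succ, h₁, h₂, h₅, h₆, ← h₃, ← h₄, dual_smul_sub_smul,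
      LinearMap.smul_apply, map_sub, smul_eq_mul, mul_comm]

end ScalarReduction

/-! ### Leading coefficients of the columns -/

section TopologicalEpsilon

open scoped Topology

variable {𝕜 E : Type*} [NontriviallyNormedField 𝕜] [NormedAddCommGroup E]
  [NormedSpace 𝕜 E] {x : ℕ → 𝕜} {y : E →L[𝕜] 𝕜} {S : ℕ → E} {L v : E}

/-- The shape of the columns `ε̂_{2k-1}` and `ε̂_{2k}`: the first is a multiple of `y` that grows
like `x ^ (-2)`, the second approaches `L` at the rate `x`, both with full expansions. For `k = 0`
the first is zero. -/
structure ColumnExpansion (x : ℕ → 𝕜) (y : E →L[𝕜] 𝕜) (S : ℕ → E) (L v : E) (k : ℕ) : Prop where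
  odd : ∃ h, HasExpansion x h (-((k : 𝕜) * (k + 1)) / (2 * y v)) ∧ ∀ᶠ n in atTop,
    (topEpsColumns (y : Module.Dual 𝕜 E) S k).1 n = ((x n ^ 2)⁻¹ * h n) • (y : Module.Dual 𝕜 E)
  even : ∃ p, HasExpansion x p (((k : 𝕜) + 1)⁻¹ • v) ∧ ∀ᶠ n in atTop,
    topEpsEven (y : Module.Dual 𝕜 E) S k n = L + x n • p n

namespace ColumnExpansion

variable {k : ℕ}

theorem exists_even_sub (hx : IsHarmonicScale x) (hc : ColumnExpansion x y S L v k) :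
    ∃ D, HasExpansion x D (-(((k : 𝕜) + 1)⁻¹ • v)) ∧ ∀ᶠ n in atTop,
      topEpsEven (y : Module.Dual 𝕜 E) S k (n + 1) - topEpsEven (y : Module.Dual 𝕜 E) S k n =
        x n ^ 2 • D n := by
  obtain ⟨p, hp, hep⟩ := hc.even
  exact hp.exists_sub_eq_sq_smul hx hep

theorem exists_odd_succ [CharZero 𝕜] (hx : IsHarmonicScale x) (hv : y v ≠ 0)
    (hc : ColumnExpansion x y S L v k) :
    ∃ h, HasExpansion x h (-(((k : 𝕜) + 1) * (k + 2)) / (2 * y v)) ∧ ∀ᶠ n in atTop,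
      topEpsOdd (y : Module.Dual 𝕜 E) S k n = ((x n ^ 2)⁻¹ * h n) • (y : Module.Dual 𝕜 E) := by
  obtain ⟨h, hh, hoh⟩ := hc.odd
  obtain ⟨D, hD, heD⟩ := hc.exists_even_sub hx
  have hk : (k : 𝕜) + 1 ≠ 0 := Nat.cast_add_one_ne_zero k
  have hlim : y (-(((k : 𝕜) + 1)⁻¹ • v)) ≠ 0 := by simp [hk, hv]
  have h1 := HasExpansion.one_add_scale hx
  refine ⟨fun n => (1 + x n) * (1 + x n) * h (n + 1) + (y (D n))⁻¹, ?_, ?_⟩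
  · convert ((h1.mul hx h1).mul hx (hh.shift hx)).add ((hD.clm y).inv hx hlim) using 1
    simp only [map_neg, map_smul, smul_eq_mul]
    field_simp
    ring
  · filter_upwards [(tendsto_add_atTop_nat 1).eventually hoh, heD, hx.shift_eq, hx.eventually_ne,
      h1.tendsto.eventually_ne one_ne_zero] with n h₁ h₂ h₃ h₄ h₅
    rw [topEpsOdd_eq, h₁, h₂, h₃, ← add_smul]
    congr 1
    simp only [map_smul, smul_eq_mul, ContinuousLinearMap.coe_coe]
    rw [mul_inv]
    field_simp

theorem exists_odd_sub [CharZero 𝕜] (hx : IsHarmonicScale x) (hv : y v ≠ 0)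
    (hc : ColumnExpansion x y S L v k) :
    ∃ t, HasExpansion x t (-(((k : 𝕜) + 1) * (k + 2)) / y v) ∧ ∀ᶠ n in atTop,
      topEpsOdd (y : Module.Dual 𝕜 E) S k (n + 1) - topEpsOdd (y : Module.Dual 𝕜 E) S k n =
        ((x n)⁻¹ * t n) • (y : Module.Dual 𝕜 E) := by
  obtain ⟨h, hh, hoh⟩ := hc.exists_odd_succ hx hv
  obtain ⟨t, ht, hot⟩ := hh.exists_sub_eq_inv_mul hx (EventuallyEq.refl _ _)
  refine ⟨t, ?_, ?_⟩
  · convert ht using 1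
    field_simp
  · filter_upwards [hoh, (tendsto_add_atTop_nat 1).eventually hoh, hot] with n h₁ h₂ h₃
    rw [h₁, h₂, ← h₃, dual_smul_sub_smul]

theorem succ [CharZero 𝕜] (hx : IsHarmonicScale x) (hv : y v ≠ 0)
    (hc : ColumnExpansion x y S L v k) :
    ColumnExpansion x y S L v (k + 1) := by
  have hk : (k : 𝕜) + 1 ≠ 0 := Nat.cast_add_one_ne_zero k
  have hk₂ : (k : 𝕜) + 2 ≠ 0 := by exact_mod_cast (Nat.cast_add_one_ne_zero (k + 1) : _ ≠ (0 : 𝕜))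
  refine ⟨?_, ?_⟩
  · obtain ⟨h, hh, hoh⟩ := hc.exists_odd_succ hx hv
    refine ⟨h, ?_, hoh⟩
    convert hh using 2
    push_cast
    ring
  · obtain ⟨p, hp, hep⟩ := hc.even
    obtain ⟨D, hD, heD⟩ := hc.exists_even_sub hx
    obtain ⟨t, ht, hot⟩ := hc.exists_odd_sub hx hv
    have hlim : -(((k : 𝕜) + 1) * (k + 2)) / y v * y (-(((k : 𝕜) + 1)⁻¹ • v)) ≠ 0 := by
      simp [hk, hv, hk₂]
    refine ⟨fun n => (1 + x n)⁻¹ • p (n + 1) + (t n * y (D n))⁻¹ • D n, ?_, ?_⟩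
    -- the limit is `v / (k + 1) * (1 - 1 / (k + 2))`
    · convert ((HasExpansion.inv_one_add_scale hx).smul hx (hp.shift hx)).add
        (((ht.mul hx (hD.clm y)).inv hx hlim).smul hx hD) using 1
      simp only [map_neg, map_smul, smul_eq_mul, smul_neg, smul_smul, one_mul, ← sub_eq_add_neg,
        ← sub_smul]
      congr 1
      push_cast
      rw [add_assoc, one_add_one_eq_two]
      field_simp
      ring
    · filter_upwards [(tendsto_add_atTop_nat 1).eventually hep, heD, hot, hx.shift_eq,
        hx.eventually_ne] with n h₁ h₂ h₃ h₄ h₅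
      rw [topEpsEven_succ, h₂, h₃, h₁, h₄, add_assoc]
      congr 1
      simp only [LinearMap.smul_apply, map_smul, smul_eq_mul, ContinuousLinearMap.coe_coe,
        smul_add, smul_smul]
      congr 2
      rw [mul_inv, mul_inv, mul_inv, mul_inv]
      field_simp

theorem of_sequence [CharZero 𝕜] (hx : IsHarmonicScale x) (hv : y v ≠ 0) {p : ℕ → E}
    (hp : HasExpansion x p v)
    (hS : ∀ᶠ n in atTop, S n = L + x n • p n) (k : ℕ) : ColumnExpansion x y S L v k := by
  induction k with
  | zero =>
    refine ⟨⟨fun _ => 0, ?_, ?_⟩, ⟨p, by simpa using hp, hS⟩⟩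
    · simpa using HasExpansion.const x (0 : 𝕜)
    · simp [topEpsColumns]
  | succ k ih => exact ih.succ hx hv

theorem eventually_divisors_ne_zero [CharZero 𝕜] (hx : IsHarmonicScale x) (hv : y v ≠ 0)
    (hc : ColumnExpansion x y S L v k) : ∀ᶠ n : ℕ in atTop,
      (y : Module.Dual 𝕜 E)
          (topEpsEven (y : Module.Dual 𝕜 E) S k (n + 1) -
            topEpsEven (y : Module.Dual 𝕜 E) S k n) ≠ 0 ∧
      (topEpsOdd (y : Module.Dual 𝕜 E) S k (n + 1) - topEpsOdd (y : Module.Dual 𝕜 E) S k n)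
          (topEpsEven (y : Module.Dual 𝕜 E) S k (n + 1) -
            topEpsEven (y : Module.Dual 𝕜 E) S k n) ≠ 0 := by
  have hk : (k : 𝕜) + 1 ≠ 0 := Nat.cast_add_one_ne_zero k
  have hk₂ : (k : 𝕜) + 2 ≠ 0 := by exact_mod_cast (Nat.cast_add_one_ne_zero (k + 1) : _ ≠ (0 : 𝕜))
  obtain ⟨D, hD, heD⟩ := hc.exists_even_sub hx
  obtain ⟨t, ht, hot⟩ := hc.exists_odd_sub hx hv
  have hD₀ : y (-(((k : 𝕜) + 1)⁻¹ • v)) ≠ 0 := by simp [hk, hv]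
  have ht₀ : -(((k : 𝕜) + 1) * (k + 2)) / y v ≠ 0 := by simp [hk, hv, hk₂]
  filter_upwards [heD, hot, hx.eventually_ne, (hD.clm y).tendsto.eventually_ne hD₀,
    ht.tendsto.eventually_ne ht₀] with n h₁ h₂ h₃ h₄ h₅
  rw [h₂, h₁]
  simp [h₃, h₄, h₅]

end ColumnExpansion

end TopologicalEpsilon

/-! ### The scale `1 / (n + b)` -/

theorem isHarmonicScale_inv_natCast_add {𝕜 : Type*} [RCLike 𝕜] (b : 𝕜) :
    IsHarmonicScale fun n : ℕ => ((n : 𝕜) + b)⁻¹ := by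
  have hnat : Tendsto (fun n : ℕ => ‖(n : 𝕜) + b‖) atTop atTop := by
    refine tendsto_atTop_mono (f := fun n : ℕ => (n : ℝ) + -‖b‖) (fun n => ?_)
      (tendsto_atTop_add_const_right _ _ tendsto_natCast_atTop_atTop)
    have := norm_sub_norm_le (n : 𝕜) (-b)
    simpa [sub_eq_add_neg] using this
  have hne : ∀ᶠ n : ℕ in atTop, (n : 𝕜) + b ≠ 0 :=
    (hnat.eventually_gt_atTop 0).mono fun n => norm_pos_iff.1
  refine ⟨?_, hne.mono fun n => inv_ne_zero, ?_⟩
  · rw [tendsto_zero_iff_norm_tendsto_zero]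
    simp only [norm_inv]
    exact hnat.inv_tendsto_atTop
  · filter_upwards [hne, (tendsto_add_atTop_nat 1).eventually hne] with n h₁ h₂
    have h₃ : 1 + ((n : 𝕜) + b)⁻¹ = ((n + 1 : ℕ) + b) * ((n : 𝕜) + b)⁻¹ := by
      push_cast
      field_simp
      ring
    rw [h₃, mul_inv, inv_inv, mul_left_comm, inv_mul_cancel₀ h₁, mul_one]

theorem HasLogExpansion.exists_hasExpansion {𝕜 E : Type*} [RCLike 𝕜] [NormedAddCommGroup E]
    [NormedSpace 𝕜 E] {S : ℕ → E} {L : E} {a : ℕ → 𝕜} {b : 𝕜} {u : ℕ → E}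
    (hS : HasLogExpansion S L a b u) :
    ∃ p, HasExpansion (fun n : ℕ => ((n : 𝕜) + b)⁻¹) p (a 1 • u 1) ∧
      ∀ᶠ n : ℕ in atTop, S n = L + ((n : 𝕜) + b)⁻¹ • p n := by
  have hx := isHarmonicScale_inv_natCast_add b
  have hlim : Tendsto (fun n => S n - L) atTop (nhds 0) := by
    have h := hS 0
    simp only [pow_zero, inv_one, isLittleO_one_iff] at h
    simpa using h
  have hexp : HasExpansion (fun n : ℕ => ((n : 𝕜) + b)⁻¹) (fun n => S n - L) 0 := by
    refine ⟨fun N => ?_, hlim⟩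
    refine HasExpansionTo.of_isBigO hx.eventually_ne (fun i => if i = 0 then 0 else a i • u i) ?_
    refine (hS N).isBigO.congr (fun n => ?_) fun n => (inv_pow _ _).symm
    rw [Finset.range_eq_Ico, Finset.sum_eq_sum_Ico_succ_bot (Nat.succ_pos N)]
    simp only [if_true, smul_zero, zero_add]
    congr 1
    refine Finset.sum_congr rfl fun i hi => ?_
    have hi0 : i ≠ 0 := by
      have := (Finset.mem_Icc.1 hi).1
      omega
    rw [if_neg hi0, smul_smul, inv_pow, mul_comm]
  obtain ⟨p, d, hp, hSp⟩ := hexp.exists_eq_add_smul hx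
  have hd : d = a 1 • u 1 := by
    have h := hS 1
    have h₁ := ((isBigO_refl (fun n : ℕ => (n : 𝕜) + b) atTop).smul_isLittleO h).congr'
      (g₂ := fun _ => (1 : 𝕜)) (f₂ := fun n => p n - a 1 • u 1) ?_ ?_
    · rw [isLittleO_one_iff] at h₁
      refine tendsto_nhds_unique hp.tendsto ?_
      simpa using h₁.add_const (a 1 • u 1)
    · filter_upwards [hSp, hx.eventually_ne] with n h₂ h₃
      have h₄ : (n : 𝕜) + b ≠ 0 := fun h => h₃ (by rw [h, inv_zero])
      rw [h₂, Finset.Icc_self, Finset.sum_singleton, zero_add, pow_one, mul_comm (a 1), mul_smul,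
        ← smul_sub, smul_smul, mul_inv_cancel₀ h₄, one_smul]
    · filter_upwards [hx.eventually_ne] with n h₃
      have h₄ : (n : 𝕜) + b ≠ 0 := fun h => h₃ (by rw [h, inv_zero])
      rw [smul_eq_mul, pow_one, mul_inv_cancel₀ h₄]
  subst hd
  exact ⟨p, hp, hSp.mono fun n hn => sub_eq_iff_eq_add'.1 (hn.trans (zero_add _))⟩

/-! ### Behaviour of the even columns -/

theorem mainTheorem6 {𝕜 E : Type*} [RCLike 𝕜] [NormedAddCommGroup E] [NormedSpace 𝕜 E]
    (y : E →L[𝕜] 𝕜) (S : ℕ → E) (L : E) (a : ℕ → 𝕜) (b : 𝕜) (u : ℕ → E)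
    (hS : HasLogExpansion S L a b u) (hy : a 1 * y (u 1) ≠ 0) :
    -- every division in the algorithms is by a nonzero number, for all large `n`
    (∀ k : ℕ, ∀ᶠ n : ℕ in atTop,
      (y : Module.Dual 𝕜 E)
          (topEpsEven (y : Module.Dual 𝕜 E) S k (n + 1) -
            topEpsEven (y : Module.Dual 𝕜 E) S k n) ≠ 0 ∧
      (topEpsOdd (y : Module.Dual 𝕜 E) S k (n + 1) - topEpsOdd (y : Module.Dual 𝕜 E) S k n)
          (topEpsEven (y : Module.Dual 𝕜 E) S k (n + 1) -
            topEpsEven (y : Module.Dual 𝕜 E) S k n) ≠ 0) ∧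
    (∀ k : ℕ, ∀ᶠ n : ℕ in atTop,
      scalarEps (fun m => y (S m)) k (n + 1) - scalarEps (fun m => y (S m)) k n ≠ 0) ∧
    -- the first topological algorithm and its simplified form give the same even columns
    (∀ k : ℕ, ∀ᶠ n : ℕ in atTop,
      simplTopEps (y : Module.Dual 𝕜 E) S k n = topEpsEven (y : Module.Dual 𝕜 E) S k n) ∧
    -- the asymptotic behaviour of each fixed even column
    (∀ k : ℕ,
      (fun n : ℕ => topEpsEven (y : Module.Dual 𝕜 E) S k n - L) ~[atTop]
        (fun n : ℕ => (a 1 / (((k : 𝕜) + 1) * ((n : 𝕜) + b))) • u 1)) ∧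
    -- no even column converges to the limit faster than an earlier one
    (∀ k l : ℕ, k < l →
      ¬ Tendsto (fun n : ℕ => ‖topEpsEven (y : Module.Dual 𝕜 E) S l n - L‖ /
          ‖topEpsEven (y : Module.Dual 𝕜 E) S k n - L‖) atTop (nhds 0)) := by
  have hx := isHarmonicScale_inv_natCast_add b
  have hv : y (a 1 • u 1) ≠ 0 := by simpa using hy
  obtain ⟨p, hp, hSp⟩ := hS.exists_hasExpansion
  have hcol := ColumnExpansion.of_sequence hx hv hp hSp
  have hdiv := fun k => (hcol k).eventually_divisors_ne_zero hx hv
  have hdiv' := fun k => (hdiv k).mono fun n h => h.1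
  have hne : ∀ k : ℕ, ((k : 𝕜) + 1)⁻¹ • a 1 • u 1 ≠ 0 := fun k h => by
    rw [smul_eq_zero_iff_right (inv_ne_zero (Nat.cast_add_one_ne_zero k))] at h
    simp [h] at hv
  refine ⟨hdiv, eventually_scalarEps_sub_ne_zero hdiv, eventually_simplTopEps_eq hdiv', ?_, ?_⟩
  · intro k
    obtain ⟨q, hq, heq⟩ := (hcol k).even
    have hrhs : ∀ n : ℕ, (a 1 / (((k : 𝕜) + 1) * ((n : 𝕜) + b))) • u 1 =
        ((n : 𝕜) + b)⁻¹ • ((k : 𝕜) + 1)⁻¹ • a 1 • u 1 := fun n => by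
      rw [smul_smul, smul_smul, div_eq_mul_inv, mul_inv]
      congr 1
      ring
    simp only [hrhs]
    refine IsEquivalent.congr_left (u := fun n : ℕ => ((n : 𝕜) + b)⁻¹ • q n) ?_ ?_
    · exact IsEquivalent.refl.smul ((isEquivalent_const_iff_tendsto (hne k)).2 hq.tendsto)
    · filter_upwards [heq] with n hn
      rw [hn, add_sub_cancel_left]
  · intro k l _ hlim
    obtain ⟨q, hq, heq⟩ := (hcol k).even
    obtain ⟨r, hr, her⟩ := (hcol l).even
    -- the common factor `1 / (n + b)` cancels, and the ratio tends to `(k + 1) / (l + 1)`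
    have hratio := hr.tendsto.norm.div hq.tendsto.norm (norm_ne_zero_iff.2 (hne k))
    refine div_ne_zero (norm_ne_zero_iff.2 (hne l)) (norm_ne_zero_iff.2 (hne k))
      (tendsto_nhds_unique (hratio.congr' ?_) hlim)
    filter_upwards [heq, her, hx.eventually_ne] with n h₁ h₂ h₃
    rw [h₁, h₂, add_sub_cancel_left, add_sub_cancel_left, norm_smul, norm_smul,
      mul_div_mul_left _ _ (norm_ne_zero_iff.2 h₃), Pi.div_apply]
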